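/- **Setting.** Fix $\varepsilon>0$ and $N\in\mathbb N$, and let $\mathcal I=\{i\varepsilon : i\in\{0,\dots,N-1\}\}$ be the set of possible bids. Let $m=\lfloor\log_2(N\varepsilon)\rfloor$, and assume $m\ge 1$ and $2^i\in\mathcal I$ for all $i\in\{0,\dots,m\}$. Consider the following Bayesian first-price auction between an *optimizer* and a *learner*. The optimizer's value for the item is $v_O=1$. The learner's value $v_L$ is private, with $\Pr[v_L=2^i]=2^{-(m-i)}$ for $1\le i\le m-1$ and $\Pr[v_L=2^m]=2^{-(m-1)}$. Both submit a bid in $\mathcal I$; the higher bid wins, ties are won by the learner, the winner gets its value minus its bid, and the other player gets $0$. Write $u_L(x,y,v)$ for the learner's utility when the optimizer bids $x$, the learner bids $y$ and $v_L=v$. The *Stackelberg utility* $V$ is the maximum of the optimizer's expected utility over all pairs $(\alpha,f)$, where $\alpha$ is a probability distribution on the optimizer's bids and $f$ is a map from the learner's values to bids that maximizes the learner's expected utility against $\alpha$. The auction is repeated for $T$ rounds, with the learner's values $v_L^1,\dots,v_L^T$ drawn independently. In each round the learner, using a randomized algorithm, chooses a bid based on its current value and on the values and bids of the earlier rounds.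 The learner is *$\gamma$-mean-based* if for every sequence $x_1,\dots,x_T\in\mathcal I$ of optimizer's bids, every round $t$, every value $v$ in the support of the prior and every bid $y\in\mathcal I$ the following holds: if some $y'\in\mathcal I$ satisfies $\sum_{s\le t}u_L(x_s,y,v)<\sum_{s\le t}u_L(x_s,y',v)-\gamma T$, then the probability that the learner bids $y$ at round $t$, conditioned on $v_L^t=v$, is at most $\gamma$. **Theorem.** There are absolute constants $\kappa,\delta>0$ such that for all $\varepsilon$, $N$ as above, all $T$ and all $\gamma$ with $\gamma N\le\delta$ (in particular, eventually, whenever $\gamma N=o(1)$), there is a fixed (oblivious) sequence of bids $b_1,\dots,b_T\in\mathcal I\cap[0,1]$ of the optimizer with the following properties. The sequence splits into $m+1$ consecutive (possibly empty) phases, where all bids in the first phase are $0$ and the bids within each phase are in non-decreasing order; and against every $\gamma$-mean-based learner, bidding $b_1,\dots,b_T$ gives the optimizer an expected total utility in the $T$ rounds of at least $$\kappa\cdot\log_2(N\varepsilon)\cdot V\cdot T .$$ Consequently, the optimizer's optimal expected utility in $T$ rounds against any such learner is $\Omega(\log(N\varepsilon))\cdot V\cdot T$. -/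

import Mathlib

noncomputable section

/-- A finite Bayesian game: `M` actions of the optimizer, `N` actions of the learner, `C` contexts
(private types of the learner) drawn from `prior`, and the utilities of both players given the
optimizer's action, the learner's action and the context. -/
structure BayesianGame (M N C : ℕ) where
  prior : Fin C → ℝ
  prior_mem : prior ∈ stdSimplex ℝ (Fin C)
  uO : Fin M → Fin N → Fin C → ℝ
  uL : Fin M → Fin N → Fin C → ℝ

namespace BayesianGame

variable {M N C : ℕ} (G : BayesianGame M N C)

/-- `u_O(α, f)`: expected utility of the optimizer for a mixed strategy `α` of the optimizer and a
pure strategy `f` of the learner. -/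
def optUtility (α : Fin M → ℝ) (f : Fin C → Fin N) : ℝ :=
  ∑ c, G.prior c * ∑ i, α i * G.uO i (f c) c

/-- `u_L(α, f)`: the same for the learner. -/
def learnerUtility (α : Fin M → ℝ) (f : Fin C → Fin N) : ℝ :=
  ∑ c, G.prior c * ∑ i, α i * G.uL i (f c) c

def IsBestResponse (α : Fin M → ℝ) (f : Fin C → Fin N) : Prop :=
  ∀ f' : Fin C → Fin N, G.learnerUtility α f' ≤ G.learnerUtility α f

/-- The values `u_O(α, f)` over all mixed strategies `α` and all best responses `f` to `α`. -/
def stackelbergValues : Set ℝ :=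
  {v | ∃ α ∈ stdSimplex ℝ (Fin M), ∃ f : Fin C → Fin N,
    G.IsBestResponse α f ∧ G.optUtility α f = v}

/-- The Stackelberg utility `V(G)`; the supremum is a maximum by
`isGreatest_stackelbergUtility` below. -/
def stackelbergUtility : ℝ := sSup G.stackelbergValues

theorem isGreatest_stackelbergUtility [NeZero M] [NeZero N] :
    IsGreatest G.stackelbergValues G.stackelbergUtility := by
  have hU : ∀ f, Continuous fun α => G.optUtility α f := fun f => by
    unfold optUtility; fun_prop
  have hL : ∀ f, Continuous fun α => G.learnerUtility α f := fun f => by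
    unfold learnerUtility; fun_prop
  have hS : G.stackelbergValues = ⋃ f : Fin C → Fin N, (fun α => G.optUtility α f) ''
      (stdSimplex ℝ (Fin M) ∩ {α | G.IsBestResponse α f}) := by
    ext v
    simp only [stackelbergValues, Set.mem_ofPred_eq, Set.mem_iUnion, Set.mem_image,
      Set.mem_inter_iff]
    constructor
    · rintro ⟨α, hα, f, hf, hv⟩
      exact ⟨f, α, ⟨hα, hf⟩, hv⟩
    · rintro ⟨f, α, ⟨hα, hf⟩, hv⟩
      exact ⟨α, hα, f, hf, hv⟩
  have hcomp : IsCompact G.stackelbergValues := by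
    rw [hS]
    refine isCompact_iUnion fun f => IsCompact.image ?_ (hU f)
    refine (isCompact_stdSimplex ℝ (Fin M)).inter_right ?_
    have : {α | G.IsBestResponse α f} =
        ⋂ f', {α | G.learnerUtility α f' ≤ G.learnerUtility α f} := by
      ext α; simp [IsBestResponse]
    rw [this]
    exact isClosed_iInter fun f' => isClosed_le (hL f') (hL f)
  refine hcomp.isGreatest_sSup ?_
  obtain ⟨f, hf⟩ := Finite.exists_max fun f : Fin C → Fin N =>
    G.learnerUtility (Pi.single 0 1) f
  exact ⟨_, Pi.single 0 1, single_mem_stdSimplex ℝ 0, f, hf, rfl⟩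

end BayesianGame

/-- The discrete space `{i · ε | i ∈ {0, …, N - 1}}` of values and bids. -/
def bidSpace (N : ℕ) (ε : ℝ) : Set ℝ := {x | ∃ i : Fin N, x = (i : ℕ) * ε}

/-- The Bayesian first-price auction with bids `i · ε`, `i < N`, in which the optimizer has value
`vO` and the learner has value `value c` in context `c`. Ties are won by the learner. -/
def firstPriceAuction (N C : ℕ) (ε vO : ℝ) (value prior : Fin C → ℝ)
    (hprior : prior ∈ stdSimplex ℝ (Fin C)) : BayesianGame N N C where
  prior := prior
  prior_mem := hprior
  uO i j _ := if j < i then vO - (i : ℕ) * ε else 0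
  uL i j c := if i ≤ j then value c - (j : ℕ) * ε else 0

/-- Context `k : Fin m` stands for the value `2 ^ (k + 1)`. It has probability
`1 / 2 ^ (m - (k + 1))` if `k + 1 < m`, and `1 / 2 ^ (m - 1)` if `k + 1 = m`. -/
def geometricPrior (m : ℕ) (k : Fin m) : ℝ :=
  if (k : ℕ) + 1 < m then 1 / 2 ^ (m - ((k : ℕ) + 1)) else 1 / 2 ^ (m - 1)

theorem geometricPrior_mem {m : ℕ} (hm : 1 ≤ m) :
    geometricPrior m ∈ stdSimplex ℝ (Fin m) := by
  refine ⟨fun k => by unfold geometricPrior; split_ifs <;> positivity, ?_⟩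
  obtain ⟨n, rfl⟩ : ∃ n, m = n + 1 := ⟨m - 1, by omega⟩
  rw [Fin.sum_univ_castSucc]
  have h1 : ∀ k : Fin n, geometricPrior (n + 1) k.castSucc = 1 / 2 ^ (n - (k : ℕ)) := by
    intro k
    have := k.isLt
    simp [geometricPrior]
  have h2 : geometricPrior (n + 1) (Fin.last n) = 1 / 2 ^ n := by
    simp [geometricPrior]
  rw [h2, Finset.sum_congr rfl fun k _ => h1 k,
    Fin.sum_univ_eq_sum_range (fun k => (1 : ℝ) / 2 ^ (n - k)) n]
  clear h1 h2 hm
  induction n with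
  | zero => simp
  | succ n ih =>
    rw [Finset.sum_range_succ']
    simp only [Nat.add_sub_add_right, Nat.sub_zero]
    have : (1 : ℝ) / 2 ^ (n + 1) + 1 / 2 ^ (n + 1) = 1 / 2 ^ n := by
      field_simp; ring
    linarith

/-- Optimizer's value `1`; learner's value `2 ^ i`, `1 ≤ i ≤ m`, with the geometric prior. -/
def geometricAuction (N m : ℕ) (ε : ℝ) (hm : 1 ≤ m) : BayesianGame N N m :=
  firstPriceAuction N m ε 1 (fun k => 2 ^ ((k : ℕ) + 1)) (geometricPrior m)
    (geometricPrior_mem hm)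

/-- The entries of a sequence strictly before round `t`. -/
def history {X : Type*} {T : ℕ} (a : Fin T → X) (t : Fin T) : Fin (t : ℕ) → X :=
  fun s => a ⟨s, s.isLt.trans t.isLt⟩

/-- A deterministic algorithm of the learner for `T` rounds: its action at round `t`, given the
past actions of the optimizer, the past contexts and the current context. (Its own past actions
are then determined.) -/
abbrev LearnerAlg (M N C T : ℕ) : Type :=
  (t : Fin T) → (Fin (t : ℕ) → Fin M) → (Fin (t : ℕ) → Fin C) → Fin C → Fin N

/-- A learner: a randomized algorithm, that is, a probability distribution over the finitely many
deterministic ones (the law of the algorithm under its internal random string). -/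
structure Learner (M N C T : ℕ) where
  weight : LearnerAlg M N C T → ℝ
  weight_mem : weight ∈ stdSimplex ℝ (LearnerAlg M N C T)

/-- The action of the deterministic algorithm `A` at round `t` when the optimizer plays the
sequence `a` and the contexts are `x`. -/
def LearnerAlg.play {M N C T : ℕ} (A : LearnerAlg M N C T) (a : Fin T → Fin M)
    (x : Fin T → Fin C) (t : Fin T) : Fin N :=
  A t (history a t) (history x t) (x t)

namespace BayesianGame

variable {M N C T : ℕ} (G : BayesianGame M N C)

/-- Probability that the contexts of the `T` rounds, which are independent, are `x`. -/
def contextProb (x : Fin T → Fin C) : ℝ := ∏ t, G.prior (x t)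

/-- `σ_{j,t}(c)`: cumulative utility of action `j` for context `c` in the rounds up to and
including `t`, when the optimizer plays `a`. -/
def cumUtility (a : Fin T → Fin M) (t : Fin T) (c : Fin C) (j : Fin N) : ℝ :=
  ∑ s ∈ Finset.Iic t, G.uL (a s) j c

/-- The probability, over the learner's randomness and the contexts, that the context of round `t`
is `c` and that the learner plays `j` at round `t`, when the optimizer plays `a`. -/
def playProb (L : Learner M N C T) (a : Fin T → Fin M) (t : Fin T) (c : Fin C) (j : Fin N) : ℝ :=
  ∑ A, ∑ x : Fin T → Fin C,
    if x t = c ∧ A.play a x t = j then L.weight A * G.contextProb x else 0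

/-- The learner is `γ`-mean-based: conditioned on context `c` at round `t`, the probability of
playing `j` at round `t` is at most `γ` whenever `σ_{j,t}(c) < σ_{j',t}(c) - γ T` for some `j'`.
The bound on the conditional probability is multiplied by the probability `G.prior c` of the
condition. -/
def IsMeanBased (γ : ℝ) (L : Learner M N C T) : Prop :=
  ∀ (a : Fin T → Fin M) (t : Fin T) (c : Fin C) (j : Fin N),
    (∃ j' : Fin N, G.cumUtility a t c j < G.cumUtility a t c j' - γ * T) →
      G.playProb L a t c j ≤ γ * G.prior c

/-- The optimizer's expected total utility in `T` rounds, when it plays the fixed sequence `a`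
against the learner `L`. -/
def expectedUtility (L : Learner M N C T) (a : Fin T → Fin M) : ℝ :=
  ∑ A, ∑ x : Fin T → Fin C,
    L.weight A * G.contextProb x * ∑ t, G.uO (a t) (A.play a x t) (x t)

end BayesianGame

/-- The bid sequence `b` splits into consecutive phases `0, 1, …, m` (some possibly empty): all
bids of phase `0` are zero, and within each phase the bids are in increasing order. -/
def IsPhased (m : ℕ) {N T : ℕ} (b : Fin T → Fin N) : Prop :=
  ∃ φ : Fin T → Fin (m + 1), Monotone φ ∧ (∀ t, φ t = 0 → (b t : ℕ) = 0) ∧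
    ∀ s t, s ≤ t → φ s = φ t → b s ≤ b t

end

/-! Write `v = 2 ^ (c + 1)` for the learner's value; its probability is at most `v / 2 ^ m`, with
equality below the top value.

Stackelberg side: let `F` be the distribution function of the optimizer's bid. A best response `y`
to value `v` maximizes `(v - y) * F y`, so `v * (F z - F y) ≤ z * F z - y * F y` for every bid `z`.
As the values are geometric, these inequalities telescope (`sum_two_pow_mul_posPart_le`); at `z = 1`
they give `V ≤ 2 / 2 ^ m`, with no factor `m`.

Dynamic side: bid `0` for half of the rounds, then a constant `x` between `1/3` and `1/2`. After the
first half, bid `0` has a lead of order `T` in cumulative utility over bids that beat `x`. A learner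
of value `v` loses at most `v` of it per round, so it keeps bidding `0` for about `T / (12 * v)`
rounds (`le_playProb_twoBlockBids`). Weighted by the probability of `v`, each value below the top
one yields order `T / 2 ^ m`; summing over the values gives order `m * T / 2 ^ m`, which exceeds `V
* T` by a factor of order `m`.

The windows must contain a round even for large `v`. This follows from `γ * T ≥ 1`
(`one_le_of_isMeanBased`), which with `γ * N ≤ 1 / 24` forces `T ≥ 24 * N`. -/

/-! ### Play probabilities, best responses and mean-based learners in a general game -/

namespace BayesianGame

variable {M N C T : ℕ} (G : BayesianGame M N C)

/-- The context of a single round has law `prior`. -/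
theorem sum_contextProb_of_eq (t : Fin T) (c : Fin C) :
    ∑ x : Fin T → Fin C, (if x t = c then G.contextProb x else 0) = G.prior c := by
  -- The indicator is absorbed into the factor of round `t`, so that the sum over sequences factors
  -- into a product over rounds.
  have h1 : ∀ x : Fin T → Fin C, (if x t = c then G.contextProb x else 0) =
      ∏ s, if s = t then (if x s = c then G.prior (x s) else 0) else G.prior (x s) := by
    intro x
    by_cases hx : x t = c
    · rw [if_pos hx]
      refine Finset.prod_congr rfl fun s _ => ?_
      by_cases hs : s = t
      · subst hs; simp [hx]
      · simp [hs]
    · rw [if_neg hx]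
      exact (Finset.prod_eq_zero (Finset.mem_univ t) (by simp [hx])).symm
  rw [Finset.sum_congr rfl fun x _ => h1 x]
  have h2 := (Finset.prod_univ_sum (fun _ : Fin T => (Finset.univ : Finset (Fin C)))
    (fun s d => if s = t then (if d = c then G.prior d else 0) else G.prior d)).symm
  rw [Fintype.piFinset_univ] at h2
  rw [h2, Finset.prod_eq_single t]
  · simp
  · intro s _ hs
    simp [hs, G.prior_mem.2]
  · simp

theorem prior_nonneg (c : Fin C) : 0 ≤ G.prior c := G.prior_mem.1 c

theorem contextProb_nonneg (x : Fin T → Fin C) : 0 ≤ G.contextProb x :=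
  Finset.prod_nonneg fun _ _ => G.prior_nonneg _

theorem playProb_nonneg (L : Learner M N C T) (a : Fin T → Fin M) (t : Fin T) (c : Fin C)
    (j : Fin N) : 0 ≤ G.playProb L a t c j := by
  refine Finset.sum_nonneg fun A _ => Finset.sum_nonneg fun x _ => ?_
  split_ifs
  · exact mul_nonneg (L.weight_mem.1 A) (G.contextProb_nonneg x)
  · exact le_rfl

theorem sum_playProb (L : Learner M N C T) (a : Fin T → Fin M) (t : Fin T) (c : Fin C) :
    ∑ j, G.playProb L a t c j = G.prior c := by
  have h : ∀ A : LearnerAlg M N C T, ∑ j, ∑ x : Fin T → Fin C,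
      (if x t = c ∧ A.play a x t = j then L.weight A * G.contextProb x else 0) =
      L.weight A * G.prior c := by
    intro A
    rw [Finset.sum_comm, ← G.sum_contextProb_of_eq t c, Finset.mul_sum]
    refine Finset.sum_congr rfl fun x _ => ?_
    by_cases hx : x t = c <;> simp [hx]
  unfold playProb
  rw [Finset.sum_comm, Finset.sum_congr rfl fun A _ => h A, ← Finset.sum_mul, L.weight_mem.2,
    one_mul]

/-- The mean-based condition controls only the probabilities `playProb`; this makes them sufficient
for computing the utility. -/
theorem expectedUtility_eq_sum_playProb (L : Learner M N C T) (a : Fin T → Fin M) :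
    G.expectedUtility L a = ∑ t, ∑ c, ∑ j, G.playProb L a t c j * G.uO (a t) j c := by
  have h : ∀ t, ∑ c, ∑ j, G.playProb L a t c j * G.uO (a t) j c =
      ∑ A, ∑ x : Fin T → Fin C,
        L.weight A * G.contextProb x * G.uO (a t) (A.play a x t) (x t) := by
    intro t
    simp only [playProb, Finset.sum_mul]
    rw [Finset.sum_congr rfl fun c _ => Finset.sum_comm, Finset.sum_comm]
    refine Finset.sum_congr rfl fun A _ => ?_
    rw [Finset.sum_congr rfl fun c _ => Finset.sum_comm, Finset.sum_comm]
    refine Finset.sum_congr rfl fun x _ => ?_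
    rw [Finset.sum_eq_single (x t), Finset.sum_eq_single (A.play a x t)]
    · simp
    · intro j _ hj
      simp [hj.symm]
    · simp
    · intro c _ hc
      simp [hc.symm]
    · simp
  rw [Finset.sum_congr rfl fun t _ => h t, Finset.sum_comm]
  refine Finset.sum_congr rfl fun A _ => ?_
  rw [Finset.sum_comm]
  exact Finset.sum_congr rfl fun x _ => Finset.mul_sum _ _ _

/-- In the first round the learner knows nothing about the optimizer's sequence. -/
theorem playProb_first (L : Learner M N C T) (a a' : Fin T → Fin M) (t : Fin T)
    (ht : (t : ℕ) = 0) (c : Fin C) (j : Fin N) :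
    G.playProb L a t c j = G.playProb L a' t c j := by
  have h : history a t = history a' t := by
    funext s
    exact absurd s.isLt (by omega)
  unfold playProb LearnerAlg.play
  rw [h]

/-- A best response is optimal in every context of positive probability. -/
theorem IsBestResponse.le {G : BayesianGame M N C} {α : Fin M → ℝ} {f : Fin C → Fin N}
    (hf : G.IsBestResponse α f) {c : Fin C} (hc : 0 < G.prior c) (j : Fin N) :
    ∑ i, α i * G.uL i j c ≤ ∑ i, α i * G.uL i (f c) c := by
  -- Deviating in the single context `c` leaves all other terms unchanged.
  have h := hf (Function.update f c j)
  unfold learnerUtility at h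
  rw [← Finset.add_sum_erase _ _ (Finset.mem_univ c),
    ← Finset.add_sum_erase _ _ (Finset.mem_univ c),
    Finset.sum_congr (g := fun d => G.prior d * ∑ i, α i * G.uL i (f d) d)
      (s₁ := Finset.univ.erase c) rfl] at h
  · simp only [Function.update_self] at h
    exact le_of_mul_le_mul_left (by linarith) hc
  · intro d hd
    rw [Function.update_of_ne (Finset.ne_of_mem_erase hd)]

/-- If every other action is far behind action `j₀`, a mean-based learner mostly plays `j₀`. -/
theorem IsMeanBased.le_playProb {G : BayesianGame M N C} {γ : ℝ} {L : Learner M N C T}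
    (hL : G.IsMeanBased γ L) (hγ : 0 ≤ γ) {a : Fin T → Fin M} {t : Fin T} {c : Fin C} {j₀ : Fin N}
    (h : ∀ j, j ≠ j₀ → G.cumUtility a t c j < G.cumUtility a t c j₀ - γ * T) :
    (1 - γ * N) * G.prior c ≤ G.playProb L a t c j₀ := by
  have h1 := G.sum_playProb L a t c
  rw [← Finset.add_sum_erase _ _ (Finset.mem_univ j₀)] at h1
  have h2 : ∑ j ∈ Finset.univ.erase j₀, G.playProb L a t c j ≤
      ∑ j ∈ Finset.univ.erase j₀, γ * G.prior c :=
    Finset.sum_le_sum fun j hj => hL a t c j ⟨j₀, h j (Finset.ne_of_mem_erase hj)⟩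
  have h3 : ∑ j ∈ Finset.univ.erase j₀, γ * G.prior c ≤ ∑ _j : Fin N, γ * G.prior c :=
    Finset.sum_le_sum_of_subset_of_nonneg (Finset.erase_subset _ _)
      fun _ _ _ => mul_nonneg hγ (G.prior_nonneg c)
  have h4 : ∑ _j : Fin N, γ * G.prior c = N * (γ * G.prior c) := by simp
  linarith

end BayesianGame

/-! ### Estimates for the geometric prior -/

theorem geometricPrior_pos {m : ℕ} (k : Fin m) : 0 < geometricPrior m k := by
  unfold geometricPrior
  split_ifs <;> positivity

theorem geometricPrior_le {m : ℕ} (k : Fin m) :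
    geometricPrior m k ≤ 2 ^ ((k : ℕ) + 1) / 2 ^ m := by
  have hk := k.isLt
  unfold geometricPrior
  split_ifs with h
  · rw [div_le_div_iff₀ (by positivity) (by positivity), one_mul, ← pow_add]
    exact (congrArg _ (by omega)).le
  · have h' : (k : ℕ) + 1 = m := by omega
    rw [h', div_self (by positivity)]
    exact div_le_one_of_le₀ (one_le_pow₀ one_le_two) (by positivity)

/-- Each of the `m - 1` values below the top contributes exactly `1 / 2 ^ m`. This sum is the source
of the factor `m`. The contribution of the top value is needed only for `m = 1`. -/
theorem le_sum_geometricPrior_div {m : ℕ} (hm : 1 ≤ m) :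
    (m : ℝ) / 2 / 2 ^ m ≤ ∑ k : Fin m, geometricPrior m k / 2 ^ ((k : ℕ) + 1) := by
  obtain ⟨n, rfl⟩ : ∃ n, m = n + 1 := ⟨m - 1, by omega⟩
  rw [Fin.sum_univ_castSucc]
  have h1 : ∀ k : Fin n, geometricPrior (n + 1) k.castSucc / 2 ^ ((k.castSucc : ℕ) + 1) =
      1 / 2 ^ (n + 1) := by
    intro k
    have hk := k.isLt
    simp only [geometricPrior, Fin.val_castSucc, add_lt_add_iff_right, hk, if_true]
    rw [div_div, ← pow_add]
    congr 2
    omega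
  have h2 : geometricPrior (n + 1) (Fin.last n) / 2 ^ ((Fin.last n : ℕ) + 1) =
      1 / 2 ^ n / 2 ^ (n + 1) := by
    simp [geometricPrior]
  rw [h2, Finset.sum_congr rfl fun k _ => h1 k, Finset.sum_const, Finset.card_univ,
    Fintype.card_fin, nsmul_eq_mul, mul_one_div, ← add_div]
  refine div_le_div_of_nonneg_right ?_ (by positivity)
  rcases Nat.eq_zero_or_pos n with rfl | hn
  · norm_num
  · have : (1 : ℝ) ≤ n := by exact_mod_cast hn
    have : (0 : ℝ) ≤ 1 / 2 ^ n := by positivity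
    push_cast
    linarith

/-! ### The telescoping inequality behind the Stackelberg bound -/

/-- If, for each `k < n`, the point `y k` maximizes `(2 ^ (k + 1) - j ε) F j`, then the weighted
sum of the increments of `F` above the points `y k` telescopes. -/
theorem sum_two_pow_mul_posPart_le {N : ℕ} {ε : ℝ} (hε : 0 ≤ ε) {F : Fin N → ℝ}
    (hF : Monotone F) (hF0 : ∀ j, 0 ≤ F j) (y : ℕ → Fin N) (n : ℕ)
    (hy : ∀ k < n, ∀ j : Fin N, (2 ^ (k + 1) - (j : ℕ) * ε) * F j ≤
      (2 ^ (k + 1) - (y k : ℕ) * ε) * F (y k)) (z : Fin N) :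
    ∑ k ∈ Finset.range n, 2 ^ (k + 1) * max (F z - F (y k)) 0 ≤ 2 * ((z : ℕ) * ε * F z) := by
  induction n generalizing z with
  | zero =>
    have := mul_nonneg (mul_nonneg (Nat.cast_nonneg (α := ℝ) (z : ℕ)) hε) (hF0 z)
    simpa using this
  | succ n ih =>
    have ih' := ih fun k hk => hy k (by omega)
    rw [Finset.sum_range_succ]
    rcases le_total z (y n) with hz | hz
    · rw [max_eq_right (sub_nonpos.2 (hF hz)), mul_zero, add_zero]
      exact ih' z
    · have hd : 0 ≤ F z - F (y n) := sub_nonneg.2 (hF hz)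
      -- Split each increment at `y n`: the part above it is common to all `k < n` and has total
      -- weight at most `2 ^ (n + 1)`, the weight of the new term. The part below is the induction
      -- hypothesis at `y n`. Optimality of `y n` against `z` then pays for twice the common part.
      have h1 : ∑ k ∈ Finset.range n, 2 ^ (k + 1) * max (F z - F (y k)) 0 ≤
          ∑ k ∈ Finset.range n, (2 ^ (k + 1) * (F z - F (y n)) +
            2 ^ (k + 1) * max (F (y n) - F (y k)) 0) := by
        refine Finset.sum_le_sum fun k _ => ?_
        rw [← mul_add]
        refine mul_le_mul_of_nonneg_left (max_le ?_ ?_) (by positivity)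
        · linarith [le_max_left (F (y n) - F (y k)) 0]
        · linarith [le_max_right (F (y n) - F (y k)) 0]
      have h2 : ∑ k ∈ Finset.range n, (2 : ℝ) ^ (k + 1) ≤ 2 ^ (n + 1) := by
        have h := geom_sum_eq (x := (2 : ℝ)) (by norm_num) n
        simp only [pow_succ]
        rw [← Finset.sum_mul, h]
        norm_num
      rw [Finset.sum_add_distrib, ← Finset.sum_mul] at h1
      have h3 := mul_le_mul_of_nonneg_right h2 hd
      have h4 := hy n (by omega) z
      have h5 := ih' (y n)
      rw [max_eq_left hd]
      nlinarith

/-! ### The optimizer's bid sequence -/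

/-- Bid `0` in the first half of the rounds and `k` in the second half. -/
def twoBlockBids {N : ℕ} (T : ℕ) (k : Fin N) (t : Fin T) : Fin N :=
  if (t : ℕ) < (T + 1) / 2 then ⟨0, by have := k.isLt; omega⟩ else k

theorem isPhased_twoBlockBids {N m : ℕ} (hm : 1 ≤ m) (T : ℕ) (k : Fin N) :
    IsPhased m (twoBlockBids T k) := by
  -- Only phases `0` and `1` are used; phase `1` exists because `m ≥ 1`.
  refine ⟨fun t => if (t : ℕ) < (T + 1) / 2 then 0 else ⟨1, by omega⟩, ?_, ?_, ?_⟩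
  · intro s t hst
    have : (s : ℕ) ≤ t := hst
    dsimp only
    split_ifs with h1 h2
    · exact le_rfl
    · exact Fin.zero_le _
    · omega
    · exact le_rfl
  · intro t ht
    unfold twoBlockBids
    split_ifs with h
    · rfl
    · simp [h, Fin.ext_iff] at ht
  · intro s t hst _
    have : (s : ℕ) ≤ t := hst
    unfold twoBlockBids
    split_ifs with h1 h2
    · exact le_rfl
    · exact Fin.le_def.2 (Nat.zero_le _)
    · omega
    · exact le_rfl

/-! ### Bounds on the Stackelberg utility, and the lower bound on `γ * T` -/

section GeometricAuction

variable {N m : ℕ} {ε : ℝ} {hm : 1 ≤ m}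

/-- The Stackelberg utility of the geometric auction is at most `2 / 2 ^ m`. -/
theorem stackelbergUtility_geometricAuction_le (hε : 0 < ε) (K : Fin N)
    (hK : ((K : ℕ) : ℝ) * ε = 1) :
    (geometricAuction N m ε hm).stackelbergUtility ≤ 2 / 2 ^ m := by
  have : NeZero N := ⟨by have := K.isLt; omega⟩
  obtain ⟨α, hα, f, hf, hv⟩ := (geometricAuction N m ε hm).isGreatest_stackelbergUtility.1
  rw [← hv]
  set F : Fin N → ℝ := fun j => ∑ i ∈ Finset.Iic j, α i with hFdef
  have hF : Monotone F := fun i j hij =>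
    Finset.sum_le_sum_of_subset_of_nonneg (Finset.Iic_subset_Iic.2 hij) fun k _ _ => hα.1 k
  have hF0 : ∀ j, 0 ≤ F j := fun j => Finset.sum_nonneg fun k _ => hα.1 k
  have hF1 : F K ≤ 1 := by
    rw [← hα.2]
    exact Finset.sum_le_sum_of_subset_of_nonneg (Finset.subset_univ _) fun k _ _ => hα.1 k
  have hL : ∀ (j : Fin N) (c : Fin m), ∑ i, α i * (geometricAuction N m ε hm).uL i j c =
      (2 ^ ((c : ℕ) + 1) - (j : ℕ) * ε) * F j := by
    intro j c
    have : Finset.Iic j = Finset.univ.filter (· ≤ j) := by ext; simp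
    simp only [hFdef, this, Finset.sum_filter, Finset.mul_sum]
    refine Finset.sum_congr rfl fun i _ => ?_
    simp only [geometricAuction, firstPriceAuction]
    split_ifs <;> ring
  -- Bids above `K` exceed the optimizer's value `1` and can only lose money. The remaining winning
  -- bids lie in `Ioc (f c) K` and earn at most `1` each.
  have hO : ∀ c : Fin m, ∑ i, α i * (geometricAuction N m ε hm).uO i (f c) c ≤
      max (F K - F (f c)) 0 := by
    intro c
    have h1 : ∑ i, α i * (geometricAuction N m ε hm).uO i (f c) c ≤
        ∑ i ∈ Finset.Ioc (f c) K, α i := by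
      have : Finset.Ioc (f c) K = Finset.univ.filter (fun i => f c < i ∧ i ≤ K) := by ext; simp
      rw [this, Finset.sum_filter]
      refine Finset.sum_le_sum fun i _ => ?_
      simp only [geometricAuction, firstPriceAuction]
      have hi : 0 ≤ ((i : ℕ) : ℝ) * ε := by positivity
      by_cases h1 : f c < i
      · by_cases h2 : i ≤ K
        · simp only [h1, h2, and_self, if_true]
          exact mul_le_of_le_one_right (hα.1 i) (by linarith)
        · simp only [h1, h2, and_false, if_true, if_false]
          refine mul_nonpos_of_nonneg_of_nonpos (hα.1 i) ?_
          have : ((K : ℕ) : ℝ) * ε ≤ ((i : ℕ) : ℝ) * ε :=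
            mul_le_mul_of_nonneg_right (by exact_mod_cast (not_le.1 h2).le) hε.le
          linarith
      · simp [h1]
    refine h1.trans ?_
    rcases le_total (f c) K with h | h
    · refine le_trans (le_of_eq ?_) (le_max_left _ _)
      have h2 : Finset.Iic K \ Finset.Iic (f c) = Finset.Ioc (f c) K := by
        ext i
        simp [and_comm]
      rw [← h2, eq_sub_iff_add_eq]
      exact Finset.sum_sdiff (Finset.Iic_subset_Iic.2 h)
    · rw [Finset.Ioc_eq_empty (not_lt.2 h)]
      simp
  let y : ℕ → Fin N := fun k => if h : k < m then f ⟨k, h⟩ else K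
  have hy : ∀ k : Fin m, y k = f k := fun k => by simp [y]
  have key := sum_two_pow_mul_posPart_le hε.le hF hF0 y m (fun k hk j => by
    have h := hf.le (c := ⟨k, hk⟩) (geometricPrior_pos _) j
    rw [hL, hL] at h
    simpa [y, hk] using h) K
  rw [Finset.sum_range, hK, one_mul] at key
  simp only [hy] at key
  calc (geometricAuction N m ε hm).optUtility α f
      ≤ ∑ c : Fin m, 2 ^ ((c : ℕ) + 1) / 2 ^ m * max (F K - F (f c)) 0 := by
        refine Finset.sum_le_sum fun c _ => ?_
        exact (mul_le_mul_of_nonneg_left (hO c) (geometricPrior_pos c).le).trans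
          (mul_le_mul_of_nonneg_right (geometricPrior_le c) (le_max_right _ _))
    _ = (∑ c : Fin m, 2 ^ ((c : ℕ) + 1) * max (F K - F (f c)) 0) / 2 ^ m := by
        rw [Finset.sum_div]
        exact Finset.sum_congr rfl fun c _ => by ring
    _ ≤ 2 / 2 ^ m := div_le_div_of_nonneg_right (by linarith) (by positivity)

/-- If the only positive bids are at least the optimizer's value, there is nothing to gain. -/
theorem stackelbergUtility_geometricAuction_nonpos [NeZero N] (hε : 1 ≤ ε) :
    (geometricAuction N m ε hm).stackelbergUtility ≤ 0 := by
  obtain ⟨α, hα, f, -, hv⟩ := (geometricAuction N m ε hm).isGreatest_stackelbergUtility.1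
  rw [← hv]
  refine Finset.sum_nonpos fun c _ => mul_nonpos_of_nonneg_of_nonpos
    (geometricPrior_pos c).le (Finset.sum_nonpos fun i _ =>
      mul_nonpos_of_nonneg_of_nonpos (hα.1 i) ?_)
  simp only [geometricAuction, firstPriceAuction]
  split_ifs with h
  · have h1 : (1 : ℝ) ≤ ((i : ℕ) : ℝ) := by
      have : (f c : ℕ) < i := h
      exact_mod_cast (by omega : 1 ≤ (i : ℕ))
    nlinarith
  · exact le_rfl

theorem geometricAuction_uO_nonneg {i : Fin N} (hi : ((i : ℕ) : ℝ) * ε ≤ 1) (j : Fin N)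
    (c : Fin m) : 0 ≤ (geometricAuction N m ε hm).uO i j c := by
  simp only [geometricAuction, firstPriceAuction]
  split_ifs <;> linarith

theorem expectedUtility_geometricAuction_nonneg {T : ℕ} (L : Learner N N m T) {b : Fin T → Fin N}
    (hb : ∀ t, ((b t : ℕ) : ℝ) * ε ≤ 1) :
    0 ≤ (geometricAuction N m ε hm).expectedUtility L b := by
  rw [BayesianGame.expectedUtility_eq_sum_playProb]
  exact Finset.sum_nonneg fun t _ => Finset.sum_nonneg fun c _ => Finset.sum_nonneg fun j _ =>
    mul_nonneg (BayesianGame.playProb_nonneg _ _ _ _ _ _) (geometricAuction_uO_nonneg (hb t) j c)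

/-- Since the current round counts in the mean-based condition although the learner does not see
the current bid, mean-based learners exist only if `γ T` is not too small. -/
theorem one_le_of_isMeanBased {T : ℕ} (hT : 0 < T) (K : Fin N)
    (hK : ((K : ℕ) : ℝ) * ε = 1) {γ : ℝ} (hγ : γ * N < 1) {L : Learner N N m T}
    (hL : (geometricAuction N m ε hm).IsMeanBased γ L) : 1 ≤ γ * T := by
  by_contra! hlt
  have hN : 0 < N := by have := K.isLt; omega
  let c : Fin m := ⟨0, hm⟩
  let t : Fin T := ⟨0, hT⟩
  let z : Fin N := ⟨0, hN⟩
  have hcum : ∀ (i j : Fin N), (geometricAuction N m ε hm).cumUtility (fun _ : Fin T => i) t c j =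
      if i ≤ j then 2 - (j : ℕ) * ε else 0 := by
    intro i j
    have : Finset.Iic t = {t} := by
      ext s
      simp [t, Fin.ext_iff, Fin.le_def]
    rw [BayesianGame.cumUtility, this, Finset.sum_singleton]
    simp [geometricAuction, firstPriceAuction, c]
  -- In the first round every bid is bad for some sequence: a bid of at least `1` trails bid `0` by
  -- at least `1` when the optimizer bids `0`, and a smaller bid loses to an optimizer bidding `1`,
  -- where bidding `1` would earn `2 - 1`. The play probability cannot depend on the sequence, so
  -- all bids have conditional probability at most `γ`, contradicting `γ * N < 1`.
  have hp : ∀ j, (geometricAuction N m ε hm).playProb L (fun _ => z) t c j ≤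
      γ * (geometricAuction N m ε hm).prior c := by
    intro j
    by_cases hj : 1 ≤ ((j : ℕ) : ℝ) * ε
    · refine hL _ t c j ⟨z, ?_⟩
      rw [hcum, hcum, if_pos (Fin.le_def.2 (Nat.zero_le _)), if_pos le_rfl]
      simp only [z, Nat.cast_zero]
      linarith
    · rw [BayesianGame.playProb_first _ L _ (fun _ => K) t rfl]
      refine hL _ t c j ⟨K, ?_⟩
      rw [hcum, hcum, if_pos le_rfl, hK, if_neg]
      · linarith
      · intro hKj
        apply hj
        have hK0 : 0 < ε := by
          by_contra! h0
          nlinarith [Nat.cast_nonneg (α := ℝ) (K : ℕ)]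
        rw [← hK]
        exact mul_le_mul_of_nonneg_right (by exact_mod_cast hKj) hK0.le
  have hsum := (geometricAuction N m ε hm).sum_playProb L (fun _ => z) t c
  have hle := Finset.sum_le_sum fun j (_ : j ∈ Finset.univ) => hp j
  rw [hsum] at hle
  simp only [Finset.sum_const, Finset.card_univ, Fintype.card_fin, nsmul_eq_mul] at hle
  have hpos : 0 < (geometricAuction N m ε hm).prior c := geometricPrior_pos c
  nlinarith

/-! ### Mean-based play against the two-block sequence -/

theorem cumUtility_twoBlockBids {T : ℕ} {k : Fin N} (hk : 0 < (k : ℕ)) {t : Fin T}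
    (ht : (T + 1) / 2 ≤ (t : ℕ)) (c : Fin m) (j : Fin N) :
    (geometricAuction N m ε hm).cumUtility (twoBlockBids T k) t c j =
      (2 ^ ((c : ℕ) + 1) - (j : ℕ) * ε) *
        (if k ≤ j then ((t : ℕ) + 1 : ℝ) else (((T + 1) / 2 : ℕ) : ℝ)) := by
  have h1 : ∀ s : Fin T, (geometricAuction N m ε hm).uL (twoBlockBids T k s) j c =
      if (s : ℕ) < (T + 1) / 2 ∨ k ≤ j then 2 ^ ((c : ℕ) + 1) - (j : ℕ) * ε else 0 := by
    intro s
    simp only [geometricAuction, firstPriceAuction, twoBlockBids]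
    by_cases hs : (s : ℕ) < (T + 1) / 2
    · have h0 : (⟨0, by have := k.isLt; omega⟩ : Fin N) ≤ j := Fin.le_def.2 (Nat.zero_le _)
      simp only [hs, if_true, h0, true_or]
    · simp only [hs, if_false, false_or]
  rw [BayesianGame.cumUtility, Finset.sum_congr rfl fun s _ => h1 s]
  by_cases hkj : k ≤ j
  · simp only [hkj, or_true, if_true, Finset.sum_const, Fin.card_Iic, nsmul_eq_mul]
    push_cast
    ring
  · simp only [hkj, or_false, if_false]
    rw [← Finset.sum_filter, Finset.sum_const, nsmul_eq_mul, mul_comm]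
    congr 2
    have hlt : (T + 1) / 2 < T := lt_of_le_of_lt ht t.isLt
    have : (Finset.Iic t).filter (fun s : Fin T => (s : ℕ) < (T + 1) / 2) =
        Finset.Iio (⟨(T + 1) / 2, hlt⟩ : Fin T) := by
      ext s
      simp only [Finset.mem_filter, Finset.mem_Iic, Finset.mem_Iio, Fin.le_def, Fin.lt_def]
      omega
    rw [this, Fin.card_Iio]

/-- As long as the second block is short compared to `T / 2 ^ (c + 1)`, the learner of value
`2 ^ (c + 1)` keeps bidding `0`. -/
theorem le_playProb_twoBlockBids {T : ℕ} {k : Fin N} (hε : 0 < ε) (hk : 0 < (k : ℕ))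
    (hx : 1 / 3 ≤ ((k : ℕ) : ℝ) * ε) {γ : ℝ} (hγ : 0 ≤ γ) (hγε : γ < ε / 12) {L : Learner N N m T}
    (hL : (geometricAuction N m ε hm).IsMeanBased γ L) {t : Fin T}
    (ht : (T + 1) / 2 ≤ (t : ℕ)) (c : Fin m)
    (htc : 2 ^ ((c : ℕ) + 1) * (((t : ℕ) : ℝ) + 1 - ((T + 1) / 2 : ℕ)) ≤ T / 12) :
    (1 - γ * N) * geometricPrior m c ≤
      (geometricAuction N m ε hm).playProb L (twoBlockBids T k) t c
        ⟨0, by have := k.isLt; omega⟩ := by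
  refine hL.le_playProb hγ fun j hj => ?_
  rw [cumUtility_twoBlockBids hk ht, cumUtility_twoBlockBids hk ht,
    if_neg (c := k ≤ (⟨0, _⟩ : Fin N)) (by simp [Fin.le_def]; omega)]
  have hT : (0 : ℝ) < T := by
    have := t.isLt
    exact_mod_cast (by omega : 0 < T)
  -- Rounding up in `(T + 1) / 2` makes the first block at least half of the rounds.
  have hn : (T : ℝ) / 2 ≤ ((T + 1) / 2 : ℕ) := by
    have : (T : ℝ) ≤ 2 * ((T + 1) / 2 : ℕ) := by exact_mod_cast (by omega)
    linarith
  have htn : (((T + 1) / 2 : ℕ) : ℝ) ≤ (t : ℕ) := by exact_mod_cast ht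
  set n : ℝ := (((T + 1) / 2 : ℕ) : ℝ)
  have hγT : γ * T < ε / 12 * T := mul_lt_mul_of_pos_right hγε hT
  have hj1 : (1 : ℝ) ≤ ((j : ℕ) : ℝ) := by
    have : (j : ℕ) ≠ 0 := fun h => hj (Fin.ext h)
    exact_mod_cast (by omega : 1 ≤ (j : ℕ))
  have hk1 : (1 : ℝ) ≤ ((k : ℕ) : ℝ) := by exact_mod_cast hk
  have hn0 : 0 < n := by linarith
  simp only [Nat.cast_zero, zero_mul, sub_zero]
  -- A bid `j ≥ k` gains at most `T / 12` over bid `0` by winning the second block and pays at least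
  -- `x * T / 2`; since `x ≥ 1 / 3`, it trails by at least `x * T / 4`. A bid strictly between `0`
  -- and `k` wins only the first block and overpays by at least `ε` per round there.
  split_ifs with hkj
  · have hjx : ((k : ℕ) : ℝ) * ε ≤ ((j : ℕ) : ℝ) * ε :=
      mul_le_mul_of_nonneg_right (by exact_mod_cast hkj) hε.le
    have hxε : ε ≤ ((k : ℕ) : ℝ) * ε := le_mul_of_one_le_left hε.le hk1
    set x := ((k : ℕ) : ℝ) * ε
    have h1 : (2 ^ ((c : ℕ) + 1) - ((j : ℕ) : ℝ) * ε) * (((t : ℕ) : ℝ) + 1) ≤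
        (2 ^ ((c : ℕ) + 1) - x) * (((t : ℕ) : ℝ) + 1) :=
      mul_le_mul_of_nonneg_right (by linarith) (by positivity)
    have h2 : x * n ≤ x * (((t : ℕ) : ℝ) + 1) :=
      mul_le_mul_of_nonneg_left (by linarith) (by linarith)
    have h3 : x * (T / 2) ≤ x * n := mul_le_mul_of_nonneg_left hn (by linarith)
    have h4 : ε * T ≤ x * T := mul_le_mul_of_nonneg_right hxε hT.le
    have h5 : 1 / 3 * (T : ℝ) ≤ x * T := mul_le_mul_of_nonneg_right hx hT.le
    linarith
  · have h1 : ε * n ≤ ((j : ℕ) : ℝ) * ε * n :=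
      mul_le_mul_of_nonneg_right (le_mul_of_one_le_left hε.le hj1) hn0.le
    have h3 : ε * (T / 2) ≤ ε * n := mul_le_mul_of_nonneg_left hn hε.le
    have h4 : 0 < ε * T := mul_pos hε hT
    linarith

/-- The optimizer's utility from the learner of value `2 ^ (c + 1)`. -/
theorem le_sum_playProb_twoBlockBids {T : ℕ} {k : Fin N} (hε : 0 < ε) (hk : 0 < (k : ℕ))
    (hx : 1 / 3 ≤ ((k : ℕ) : ℝ) * ε) (hx2 : ((k : ℕ) : ℝ) * ε ≤ 1 / 2) {γ : ℝ} (hγ : 0 ≤ γ)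
    (hγN : γ * N ≤ 1 / 24) (hγε : γ < ε / 12) {L : Learner N N m T}
    (hL : (geometricAuction N m ε hm).IsMeanBased γ L) (c : Fin m)
    (hT : (24 : ℝ) * 2 ^ ((c : ℕ) + 1) ≤ T) :
    (T : ℝ) / 60 * (geometricPrior m c / 2 ^ ((c : ℕ) + 1)) ≤
      ∑ t, ∑ j, (geometricAuction N m ε hm).playProb L (twoBlockBids T k) t c j *
        (geometricAuction N m ε hm).uO (twoBlockBids T k t) j c := by
  have hp := geometricPrior_pos c
  have hv2 : (2 : ℝ) ≤ 2 ^ ((c : ℕ) + 1) := by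
    rw [pow_succ]
    linarith [one_le_pow₀ (one_le_two (α := ℝ)) (n := (c : ℕ))]
  set v : ℝ := 2 ^ ((c : ℕ) + 1) with hv
  have hv0 : 0 < v := by linarith
  have hb : ∀ t, ((twoBlockBids T k t : ℕ) : ℝ) * ε ≤ 1 := by
    intro t
    unfold twoBlockBids
    split_ifs
    · simp
    · linarith
  have hnn : ∀ t j, 0 ≤ (geometricAuction N m ε hm).playProb L (twoBlockBids T k) t c j *
      (geometricAuction N m ε hm).uO (twoBlockBids T k t) j c := fun t j =>
    mul_nonneg (BayesianGame.playProb_nonneg _ _ _ _ _ _) (geometricAuction_uO_nonneg (hb t) j c)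
  -- Number of rounds of the second block in which bid `0` is guaranteed to dominate. Because `T ≥
  -- 24 * v`, taking the floor costs at most a factor `2`.
  set R : ℕ := ⌊(T : ℝ) / (12 * v)⌋₊ with hR
  have hRle : (R : ℝ) ≤ T / (12 * v) := Nat.floor_le (by positivity)
  have hRlt : (T : ℝ) / (12 * v) < R + 1 := Nat.lt_floor_add_one _
  have hRv : v * R ≤ T / 12 := by
    rw [le_div_iff₀ (by positivity)] at hRle
    linarith
  have hRT : (T : ℝ) / (24 * v) ≤ R := by
    have h1 : 1 ≤ (T : ℝ) / (24 * v) := by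
      rw [le_div_iff₀ (by positivity)]
      linarith
    have h2 : (T : ℝ) / (12 * v) = 2 * (T / (24 * v)) := by
      field_simp
      ring
    linarith
  have hRhalf : R ≤ T / 2 := by
    have : (R : ℝ) * 2 ≤ T := by nlinarith [Nat.cast_nonneg (α := ℝ) R]
    have : R * 2 ≤ T := by exact_mod_cast this
    omega
  let e : Fin R ↪ Fin T := ⟨fun r => ⟨(T + 1) / 2 + r, by have := r.isLt; omega⟩, fun r s h => by
    simp only [Fin.mk.injEq] at h
    exact Fin.ext (by omega)⟩
  have he : ∀ r, (e r : ℕ) = (T + 1) / 2 + r := fun _ => rfl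
  -- `23 / 48` is the product of `1 - 1 / 24`, bounding the probability of bid `0`, and `1 / 2`, the
  -- least profit from winning at `x ≤ 1 / 2`.
  have hterm : ∀ r : Fin R, 23 / 48 * geometricPrior m c ≤
      ∑ j, (geometricAuction N m ε hm).playProb L (twoBlockBids T k) (e r) c j *
        (geometricAuction N m ε hm).uO (twoBlockBids T k (e r)) j c := by
    intro r
    refine le_trans ?_ (Finset.single_le_sum (fun j _ => hnn (e r) j)
      (Finset.mem_univ ⟨0, by have := k.isLt; omega⟩))
    have hr : ((r : ℕ) : ℝ) + 1 ≤ R := by exact_mod_cast r.isLt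
    have hplay := le_playProb_twoBlockBids hε hk hx hγ hγε hL (t := e r) (by rw [he]; omega) c (by
      rw [he, Nat.cast_add, ← hv]
      have := mul_le_mul_of_nonneg_left hr hv0.le
      linarith)
    have hu : (geometricAuction N m ε hm).uO (twoBlockBids T k (e r))
        ⟨0, by have := k.isLt; omega⟩ c = 1 - ((k : ℕ) : ℝ) * ε := by
      have h1 : twoBlockBids T k (e r) = k := if_neg (by rw [he]; omega)
      rw [h1]
      exact if_pos (Fin.lt_def.2 hk)
    rw [hu]
    have h1 : 23 / 24 * geometricPrior m c ≤ (1 - γ * N) * geometricPrior m c :=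
      mul_le_mul_of_nonneg_right (by linarith) hp.le
    calc 23 / 48 * geometricPrior m c = 23 / 24 * geometricPrior m c * (1 / 2) := by ring
      _ ≤ _ := mul_le_mul (h1.trans hplay) (by linarith) (by norm_num)
        (BayesianGame.playProb_nonneg _ _ _ _ _ _)
  calc (T : ℝ) / 60 * (geometricPrior m c / v)
      ≤ T / (24 * v) * (23 / 48 * geometricPrior m c) := by
        have h : (T : ℝ) / (24 * v) * (23 / 48 * geometricPrior m c) =
          23 / 1152 * (T * (geometricPrior m c / v)) := by field_simp; ring
        have h0 : 0 ≤ (T : ℝ) * (geometricPrior m c / v) := by positivity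
        rw [h]
        linarith
    _ ≤ R * (23 / 48 * geometricPrior m c) := mul_le_mul_of_nonneg_right hRT (by positivity)
    _ = ∑ _r : Fin R, 23 / 48 * geometricPrior m c := by simp
    _ ≤ _ := Finset.sum_le_sum fun r _ => hterm r
    _ = ∑ t ∈ Finset.univ.map e, ∑ j,
        (geometricAuction N m ε hm).playProb L (twoBlockBids T k) t c j *
        (geometricAuction N m ε hm).uO (twoBlockBids T k t) j c := by
        rw [Finset.sum_map]
    _ ≤ _ := Finset.sum_le_sum_of_subset_of_nonneg (Finset.subset_univ _)
        fun t _ _ => Finset.sum_nonneg fun j _ => hnn t j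

theorem le_expectedUtility_twoBlockBids {T : ℕ} {k : Fin N} (hε : 0 < ε) (hk : 0 < (k : ℕ))
    (hx : 1 / 3 ≤ ((k : ℕ) : ℝ) * ε) (hx2 : ((k : ℕ) : ℝ) * ε ≤ 1 / 2) {γ : ℝ} (hγ : 0 ≤ γ)
    (hγN : γ * N ≤ 1 / 24) (hγε : γ < ε / 12) {L : Learner N N m T}
    (hL : (geometricAuction N m ε hm).IsMeanBased γ L) (hT : (24 : ℝ) * 2 ^ m ≤ T) :
    (T : ℝ) / 120 * (m / 2 ^ m) ≤
      (geometricAuction N m ε hm).expectedUtility L (twoBlockBids T k) := by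
  rw [BayesianGame.expectedUtility_eq_sum_playProb, Finset.sum_comm]
  refine le_trans ?_ (Finset.sum_le_sum fun c _ =>
    le_sum_playProb_twoBlockBids hε hk hx hx2 hγ hγN hγε hL c (le_trans ?_ hT))
  · rw [← Finset.mul_sum]
    refine le_trans (le_of_eq ?_)
      (mul_le_mul_of_nonneg_left (le_sum_geometricPrior_div hm) (by positivity))
    ring
  · exact mul_le_mul_of_nonneg_left (pow_le_pow_right₀ one_le_two c.isLt) (by norm_num)

end GeometricAuction

/-! ### Choice of constants and conclusion -/

theorem theorem4 :
    ∃ κ δ : ℝ, 0 < κ ∧ 0 < δ ∧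
      ∀ (N m : ℕ) (ε : ℝ) (_hε : 0 < ε) (_hm : m = ⌊Real.logb 2 (N * ε)⌋₊) (hm1 : 1 ≤ m)
        (_hgrid : ∀ i : ℕ, i ≤ m → (2 : ℝ) ^ i ∈ bidSpace N ε)
        (T : ℕ) (γ : ℝ), γ * N ≤ δ →
        ∃ b : Fin T → Fin N, IsPhased m b ∧ (∀ t, (b t : ℕ) * ε ≤ 1) ∧
          ∀ L : Learner N N m T, (geometricAuction N m ε hm1).IsMeanBased γ L →
            κ * Real.logb 2 (N * ε) * (geometricAuction N m ε hm1).stackelbergUtility * T ≤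
              (geometricAuction N m ε hm1).expectedUtility L b := by
  refine ⟨1 / 1000, 1 / 24, by norm_num, by norm_num, ?_⟩
  intro N m ε hε hm hm1 hgrid T γ hγN
  obtain ⟨K, hK⟩ := hgrid 0 (Nat.zero_le m)
  rw [pow_zero, eq_comm] at hK
  obtain ⟨I, hI⟩ := hgrid m le_rfl
  have hIN : ((I : ℕ) : ℝ) ≤ N := by exact_mod_cast I.isLt.le
  have hNε : (2 : ℝ) ^ m ≤ N * ε := hI ▸ mul_le_mul_of_nonneg_right hIN hε.le
  have h2m : (2 : ℝ) ≤ 2 ^ m := by simpa using pow_le_pow_right₀ (one_le_two (α := ℝ)) hm1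
  have hlog0 : 0 ≤ Real.logb 2 (N * ε) := Real.logb_nonneg one_lt_two (by linarith)
  have hlog : Real.logb 2 (N * ε) ≤ 2 * m := by
    have h1 := Nat.lt_floor_add_one (Real.logb 2 (N * ε))
    rw [← hm] at h1
    have h2 : (1 : ℝ) ≤ m := by exact_mod_cast hm1
    linarith
  have hK0 : 0 < (K : ℕ) := by
    rcases Nat.eq_zero_or_pos (K : ℕ) with h | h
    · rw [h] at hK
      norm_num at hK
    · exact h
  -- `K` is the bid `1`. Half of it, rounded down, is at least a third of it once `K ≥ 2`, with
  -- equality at `K = 3`.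
  let k : Fin N := ⟨(K : ℕ) / 2, by have := K.isLt; omega⟩
  have hkK : ((k : ℕ) : ℝ) * 2 ≤ ((K : ℕ) : ℝ) := by
    exact_mod_cast (Nat.div_mul_le_self (K : ℕ) 2)
  have hx2 : ((k : ℕ) : ℝ) * ε ≤ 1 / 2 := by
    have := mul_le_mul_of_nonneg_right hkK hε.le
    linarith
  have hb : ∀ t, ((twoBlockBids T k t : ℕ) : ℝ) * ε ≤ 1 := by
    intro t
    unfold twoBlockBids
    split_ifs
    · simp
    · linarith
  refine ⟨twoBlockBids T k, isPhased_twoBlockBids hm1 T k, hb, fun L hL => ?_⟩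
  have hnn := expectedUtility_geometricAuction_nonneg (hm := hm1) L hb
  rcases Nat.eq_zero_or_pos T with hT0 | hT0
  · subst hT0
    simpa using hnn
  -- If `K = 1`, then `ε = 1` and no bid lies strictly between `0` and `1`; here the claim holds
  -- because `V ≤ 0`.
  rcases Nat.lt_or_ge (K : ℕ) 2 with hK2 | hK2
  · have hε1 : 1 ≤ ε := by
      have h1 : (K : ℕ) = 1 := by omega
      rw [h1] at hK
      simp at hK
      exact hK.ge
    have : NeZero N := ⟨by have := K.isLt; omega⟩
    have hV := stackelbergUtility_geometricAuction_nonpos (N := N) (hm := hm1) hε1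
    refine le_trans ?_ hnn
    exact mul_nonpos_of_nonpos_of_nonneg
      (mul_nonpos_of_nonneg_of_nonpos (by positivity) hV) (by positivity)
  · have hk0 : 0 < (k : ℕ) := Nat.div_pos hK2 two_pos
    have hx : 1 / 3 ≤ ((k : ℕ) : ℝ) * ε := by
      have h1 : ((K : ℕ) : ℝ) ≤ 3 * ((k : ℕ) : ℝ) := by
        have : (K : ℕ) ≤ 3 * ((K : ℕ) / 2) := by omega
        exact_mod_cast this
      have := mul_le_mul_of_nonneg_right h1 hε.le
      linarith
    have hε1 : ε ≤ 1 := by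
      have h1 : (1 : ℝ) ≤ ((K : ℕ) : ℝ) := by exact_mod_cast hK0
      rw [← hK]
      exact le_mul_of_one_le_left hε.le h1
    have hγT := one_le_of_isMeanBased hT0 K hK (by linarith) hL
    have hTpos : (0 : ℝ) < T := by exact_mod_cast hT0
    have hγ : 0 < γ := by
      by_contra! h
      nlinarith
    -- From `N * ε ≥ 2` and `γ * N ≤ 1 / 24` one even gets `γ ≤ ε / 48`.
    have hγε : γ < ε / 12 := by
      have h1 := mul_le_mul_of_nonneg_right hγN hε.le
      have h2 : γ * 2 ≤ γ * (N * ε) := mul_le_mul_of_nonneg_left (by linarith) hγ.le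
      linarith
    have hNT : 24 * (N : ℝ) ≤ T := by
      have h1 : γ * (24 * (N : ℝ)) ≤ γ * T := by linarith
      exact le_of_mul_le_mul_left h1 hγ
    have h2N : (2 : ℝ) ^ m ≤ N := hNε.trans (mul_le_of_le_one_right (Nat.cast_nonneg N) hε1)
    have hmain := le_expectedUtility_twoBlockBids (hm := hm1) hε hk0 hx hx2 hγ.le hγN hγε hL
      (by linarith)
    refine le_trans ?_ hmain
    have hV := stackelbergUtility_geometricAuction_le (hm := hm1) hε K hK
    calc 1 / 1000 * Real.logb 2 (N * ε) * (geometricAuction N m ε hm1).stackelbergUtility * T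
        ≤ 1 / 1000 * (2 * m) * (2 / 2 ^ m) * T := by
          refine mul_le_mul_of_nonneg_right ?_ hTpos.le
          exact (mul_le_mul_of_nonneg_left hV (by positivity)).trans
            (mul_le_mul_of_nonneg_right (by linarith) (by positivity))
      _ = 4 / 1000 * ((T : ℝ) * (m / 2 ^ m)) := by ring
      _ ≤ 1 / 120 * ((T : ℝ) * (m / 2 ^ m)) :=
          mul_le_mul_of_nonneg_right (by norm_num) (by positivity)
      _ = (T : ℝ) / 120 * (m / 2 ^ m) := by ring
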